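/- Let $K$ be a compact Hausdorff space and let $A\subseteq C(K)$ be a uniform algebra which is unital or approximately unital; that is, $A$ is a norm closed subalgebra of the complex algebra $C(K)$, with the supremum norm, which has a contractive approximate identity (for example, $1\in A$). Let $P:A\to A$ be a linear map with $P\circ P=P$ which is real positive (if $a\in A$ and $\operatorname{Re}a\ge 0$ on $K$, then $\operatorname{Re}P(a)\ge 0$ on $K$) and bicontractive ($\|P\|\le 1$ and $\|I-P\|\le 1$). Then $P$ is symmetric, that is, $\|I-2P\|\le 1$. Moreover $P(A)$ is a subalgebra of $A$, and $P$ is a conditional expectation: $P(P(a)\,b\,P(c))=P(a)P(b)P(c)$ for all $a,b,c\in A$. -/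

import Mathlib

open Filter Topology

namespace UniformAlg

/-- A (not necessarily unital) normed algebra is *approximately unital* if it has a contractive
approximate identity: a (nontrivial) filter, concentrated on the closed unit ball, along which
`e * a` and `a * e` converge to `a` for each `a`. -/
def ApproximatelyUnital (A : Type*) [NonUnitalNormedRing A] : Prop :=
  ∃ l : Filter A, l.IsApproximateUnit ∧ ∀ᶠ e in l, ‖e‖ ≤ 1

/-- A *unital or approximately unital uniform algebra* on the space `K`: a norm closed
subalgebra of `C(K)` which has a contractive approximate identity. A closed subalgebra that
contains the constants, or has some identity (of norm at most one), is covered: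
see `ApproximatelyUnital.of_identity`. -/
structure IsUniformAlgebra {K : Type*} [TopologicalSpace K] [CompactSpace K]
    (A : NonUnitalSubalgebra ℂ C(K, ℂ)) : Prop where
  isClosed : IsClosed (A : Set C(K, ℂ))
  approximatelyUnital : ApproximatelyUnital A

/-- A normed algebra with an identity of norm at most one is approximately unital. -/
theorem ApproximatelyUnital.of_identity {A : Type*} [NonUnitalNormedRing A] (e : A)
    (he : ‖e‖ ≤ 1) (hl : ∀ a, e * a = a) (hr : ∀ a, a * e = a) : ApproximatelyUnital A := by
  refine ⟨pure e, ⟨fun a => ?_, fun a => ?_⟩, by simpa using he⟩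
  · simpa [hr] using tendsto_pure_nhds (fun b : A => a * b) e
  · simpa [hl] using tendsto_pure_nhds (fun b : A => b * a) e

/-- An element of a subalgebra of `C(K)` is *real positive* (accretive) if it has positive
real part. -/
def IsRealPositive {K : Type*} [TopologicalSpace K] [CompactSpace K]
    {A : NonUnitalSubalgebra ℂ C(K, ℂ)} (a : A) : Prop :=
  ∀ x : K, 0 ≤ ((a : C(K, ℂ)) x).re

/-- A linear map is *real positive* if it maps real positive elements to such elements. -/
def IsRealPositiveMap {K : Type*} [TopologicalSpace K] [CompactSpace K]
    {A : NonUnitalSubalgebra ℂ C(K, ℂ)} (T : A →ₗ[ℂ] A) : Prop :=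
  ∀ a : A, IsRealPositive a → IsRealPositive (T a)

/-- A linear map is *contractive* if its norm is at most one. -/
def IsContractive {X : Type*} [NormedAddCommGroup X] [Module ℂ X] (T : X →ₗ[ℂ] X) : Prop :=
  ∀ x : X, ‖T x‖ ≤ ‖x‖

/-- `P` is *bicontractive* if `P` and `I - P` are contractive. -/
def IsBicontractive {X : Type*} [NormedAddCommGroup X] [Module ℂ X]
    (P : X →ₗ[ℂ] X) : Prop :=
  IsContractive P ∧ IsContractive (LinearMap.id - P)

/-- `P` is *symmetric* if `I - 2P` is contractive. -/
def IsSymmetricProj {X : Type*} [NormedAddCommGroup X] [Module ℂ X]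
    (P : X →ₗ[ℂ] X) : Prop :=
  IsContractive (LinearMap.id - (2 : ℂ) • P)

/-- `P` is a *conditional expectation* if `P (P(a) b P(c)) = P(a) P(b) P(c)` for all
`a, b, c`. -/
def IsCondExp {A : Type*} [NonUnitalNormedRing A] [Module ℂ A] (P : A →ₗ[ℂ] A) : Prop :=
  ∀ a b c : A, P (P a * b * P c) = P a * P b * P c

end UniformAlg

/-! ### Approximate identities with values in a narrow sector. -/

namespace UniformAlg

/-! Symmetry is tested on a minimal closed boundary `E`. Suppose first that `1 ∈ A`, let `‖a‖ ≤ 1`,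
and let `y ∈ E` be a point at which some element of the unit ball nearly peaks. A Möbius transform
turns that element into `w` with values almost in the disc of centre 1 and radius 1, with `w y`
almost 2 and `w` small away from `y`. Since `w - 1` is almost in the unit ball, contractivity of `I
- P` forces `Re P w (y)` to be almost at least `Re P 1 (y)`. With `t = Re a(y)`, the element `2 - 2a
- (1 - t) w` is almost real positive. Applying `P` and using `Re P 1 (y) ≤ 1` gives `Re (2 P a -
a)(y) ≤ 1` up to a small error; rotating `a` gives the norm bound. This is `re_two_mul_sub_le_one`
and `isSymmetricProj`.

Hence `T = 2P - I` is a contractive involution, thus isometric. Peaking elements show that `T (b * T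
F)` at `y` essentially depends on `F` only through its value at `y`, which yields the identity in
`apply_mul_apply_mul`. So at each point where `T` does not vanish there is a scalar `u`, the limit
of `T` along an approximate identity, with `u T(ab) = T a T b`. Contractivity gives `|u| = 1` and
positivity makes `u` real. If `u = 1`, `T` is multiplicative at the point; if `u = -1`, positivity
kills `P` there (`apply_eq_zero_or_mul`). Both algebraic claims then follow pointwise.

Without a unit, `1` is replaced by an approximate identity. Multiplying by it preserves positivity
only if its values are nearly positive, hence `IsUniformAlgebra.exists_sectorial`. -/

theorem ApproximatelyUnital.exists_norm_mul_sub_le {A : Type*} [NonUnitalNormedRing A]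
    (h : ApproximatelyUnital A) (s : Finset A) {ε : ℝ} (hε : 0 < ε) :
    ∃ e : A, ‖e‖ ≤ 1 ∧ ∀ a ∈ s, ‖e * a - a‖ ≤ ε := by
  obtain ⟨l, hl, hn⟩ := h
  have := hl.neBot
  have h2 : ∀ᶠ e in l, ∀ a ∈ s, ‖e * a - a‖ ≤ ε := by
    rw [Filter.eventually_all_finset]
    intro a _
    have h3 := hl.tendsto_mul_right a
    have h4 := h3.eventually (Metric.closedBall_mem_nhds a hε)
    filter_upwards [h4] with e he
    simpa [dist_eq_norm] using he
  exact (hn.and h2).exists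

/-- A contractive approximate identity yields sequences in the unit ball, each term of which
nearly fixes all the earlier weighted partial sums. -/
theorem ApproximatelyUnital.exists_seq {A : Type*} [NonUnitalNormedRing A] [Module ℂ A]
    (h : ApproximatelyUnital A) (F : Finset A) {ε : ℝ} (hε : 0 < ε) (p : ℕ → ℂ) (η : ℕ → ℝ)
    (hη : ∀ n, 0 < η n) :
    ∃ e : ℕ → A, ∀ n, ‖e n‖ ≤ 1 ∧ (∀ a ∈ F, ‖e n * a - a‖ ≤ ε) ∧
      ∀ i ≤ n, ‖e n * (∑ j ∈ Finset.range i, p j • e j) - ∑ j ∈ Finset.range i, p j • e j‖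
        ≤ η n := by
  classical
  choose E hE1 hE2 using fun (s : Finset A) (n : ℕ) =>
    h.exists_norm_mul_sub_le s (lt_min hε (hη n))
  -- The state is the finite set to be nearly fixed so far together with the current partial sum;
  -- each new sum joins the set, so later terms nearly fix it.
  let st : ℕ → Finset A × A := fun n => Nat.rec (insert 0 F, 0)
    (fun n q => (insert (q.2 + p n • E q.1 n) q.1, q.2 + p n • E q.1 n)) n
  have hst : ∀ n, st (n + 1) = (insert ((st n).2 + p n • E (st n).1 n) (st n).1,
      (st n).2 + p n • E (st n).1 n) := fun n => rfl
  have hS : ∀ n, (st n).2 = ∑ j ∈ Finset.range n, p j • E (st j).1 j := by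
    intro n
    induction n with
    | zero => simp [st]
    | succ n ih => rw [Finset.sum_range_succ, ← ih, hst]
  have hmono : ∀ n, (st n).1 ⊆ (st (n + 1)).1 := fun n => by
    rw [hst]; exact Finset.subset_insert _ _
  have hmono' : Monotone fun n => (st n).1 := monotone_nat_of_le_succ hmono
  have hmem : ∀ n, (st n).2 ∈ (st n).1 := by
    intro n
    cases n with
    | zero => simp [st]
    | succ n => rw [hst]; exact Finset.mem_insert_self _ _
  refine ⟨fun n => E (st n).1 n, fun n => ⟨hE1 _ _, fun a ha => ?_, fun i hi => ?_⟩⟩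
  · refine (hE2 _ n a (hmono' (Nat.zero_le n) ?_)).trans (min_le_left _ _)
    simp [st, ha]
  · rw [← hS i]
    exact (hE2 _ n _ (hmono' hi (hmem i))).trans (min_le_right _ _)

variable {K : Type*} [TopologicalSpace K] [CompactSpace K] {A : NonUnitalSubalgebra ℂ C(K, ℂ)}

theorem norm_apply_le (a : A) (x : K) : ‖(a : C(K, ℂ)) x‖ ≤ ‖a‖ :=
  (a : C(K, ℂ)).norm_coe_le_norm x

theorem norm_le_of_apply {a : A} {M : ℝ} (hM : 0 ≤ M) (h : ∀ x, ‖(a : C(K, ℂ)) x‖ ≤ M) :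
    ‖a‖ ≤ M :=
  (ContinuousMap.norm_le (a : C(K, ℂ)) hM).2 h

/-- The values of the series `∑ (1 - r) r ^ j e_j` lie in a narrow sector around the positive
real axis. -/
theorem exists_norm_sub_le_of_hasSum {r : ℝ} (hr0 : 0 < r) (hr1 : r < 1) {e : ℕ → ℂ} {k : ℂ}
    (he : ∀ n, ‖e n‖ ≤ 1) (hk : HasSum (fun j => (((1 - r) * r ^ j : ℝ) : ℂ) * e j) k)
    (h : ∀ n, ∀ i ≤ n, ‖e n - 1‖ *
      ‖∑ j ∈ Finset.range i, (((1 - r) * r ^ j : ℝ) : ℂ) * e j‖ ≤ (1 - r) * ((1 - r) * r ^ n)) :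
    ∃ ρ : ℝ, 0 ≤ ρ ∧ ‖k - ρ‖ ≤ 3 * (1 - r) / r * ρ := by
  set p : ℕ → ℝ := fun j => (1 - r) * r ^ j with hp
  have hp0 : ∀ j, 0 < p j := fun j => mul_pos (by linarith) (pow_pos hr0 j)
  set S : ℕ → ℂ := fun i => ∑ j ∈ Finset.range i, (p j : ℂ) * e j with hS
  by_cases hex : ∃ n, p n < ‖S n‖
  · classical
    -- At the first index `i + 1` where the partial sum exceeds its weight, every later `e j` must
    -- be within `1 - r` of 1. The tail is then close to its total weight `r ^ (i + 1)`, which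
    -- serves as `ρ`. What precedes it, `S i` and the single term `p i * e i`, has size at most `p
    -- i` each.
    obtain ⟨hn, hmin⟩ := (⟨Nat.find_spec hex, fun m hm => Nat.find_min hex hm⟩ :
      p (Nat.find hex) < ‖S (Nat.find hex)‖ ∧ ∀ m < Nat.find hex, ¬ p m < ‖S m‖)
    obtain ⟨i, hi⟩ : ∃ i, Nat.find hex = i + 1 := by
      refine Nat.exists_eq_succ_of_ne_zero fun h0 => ?_
      rw [h0] at hn
      simp only [hS, Finset.range_zero, Finset.sum_empty, norm_zero] at hn
      exact absurd hn (not_lt.2 (hp0 0).le)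
    rw [hi] at hn hmin
    have hSi : ‖S i‖ ≤ p i := not_lt.1 (hmin i (Nat.lt_succ_self i))
    have htail : ∀ j, ‖e (j + (i + 1)) - 1‖ ≤ 1 - r := by
      intro j
      have h1 := h (j + (i + 1)) (i + 1) (by omega)
      have h2 : p (j + (i + 1)) ≤ p (i + 1) :=
        mul_le_mul_of_nonneg_left (pow_le_pow_of_le_one hr0.le hr1.le (by omega)) (by linarith)
      have h3 : ‖e (j + (i + 1)) - 1‖ * p (i + 1) ≤ (1 - r) * p (i + 1) := by
        calc _ ≤ ‖e (j + (i + 1)) - 1‖ * ‖S (i + 1)‖ := by gcongr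
          _ ≤ _ := h1
          _ ≤ _ := mul_le_mul_of_nonneg_left h2 (by linarith)
      exact le_of_mul_le_mul_right h3 (hp0 _)
    have hgeo : HasSum (fun j => p (j + (i + 1))) (r ^ (i + 1)) := by
      have := (hasSum_geometric_of_lt_one hr0.le hr1).mul_left ((1 - r) * r ^ (i + 1))
      have h1r : (1 - r) ≠ 0 := by linarith
      have h2 : (1 - r) * r ^ (i + 1) * (1 - r)⁻¹ = r ^ (i + 1) := by field_simp
      rw [h2] at this
      refine this.congr_fun fun j => ?_
      simp only [hp]; ring
    have hgeoC : HasSum (fun j => ((p (j + (i + 1)) : ℝ) : ℂ)) ((r ^ (i + 1) : ℝ) : ℂ) := by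
      exact_mod_cast hgeo
    have hk' := (hasSum_nat_add_iff' (i + 1)).2 hk
    have hdiff := hk'.sub hgeoC
    have hb : ‖k - S (i + 1) - ((r ^ (i + 1) : ℝ) : ℂ)‖ ≤ (1 - r) * r ^ (i + 1) := by
      rw [← hdiff.tsum_eq]
      refine tsum_of_norm_bounded (hgeo.mul_left (1 - r)) fun j => ?_
      have : (p (j + (i + 1)) : ℂ) * e (j + (i + 1)) - (p (j + (i + 1)) : ℂ)
          = (p (j + (i + 1)) : ℂ) * (e (j + (i + 1)) - 1) := by ring
      rw [this, norm_mul, Complex.norm_of_nonneg (hp0 _).le, mul_comm]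
      exact mul_le_mul_of_nonneg_right (htail j) (hp0 _).le
    refine ⟨r ^ (i + 1), (pow_pos hr0 _).le, ?_⟩
    have hSs : S (i + 1) = S i + (p i : ℂ) * e i := Finset.sum_range_succ _ _
    have hpe : ‖(p i : ℂ) * e i‖ ≤ p i := by
      rw [norm_mul, Complex.norm_of_nonneg (hp0 _).le]
      exact mul_le_of_le_one_right (hp0 _).le (he i)
    have h4 : k - ((r ^ (i + 1) : ℝ) : ℂ)
        = (k - S (i + 1) - ((r ^ (i + 1) : ℝ) : ℂ)) + S i + (p i : ℂ) * e i := by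
      rw [hSs]; ring
    have h5 : ‖k - ((r ^ (i + 1) : ℝ) : ℂ)‖ ≤ (1 - r) * r ^ (i + 1) + p i + p i := by
      rw [h4]
      exact (norm_add₃_le).trans (by gcongr)
    have h6 : 3 * (1 - r) / r * r ^ (i + 1) = 3 * (1 - r) * r ^ i := by
      field_simp
      ring
    rw [h6]
    have h7 : (1 - r) * r ^ (i + 1) ≤ (1 - r) * r ^ i :=
      mul_le_mul_of_nonneg_left (pow_le_pow_of_le_one hr0.le hr1.le (by omega)) (by linarith)
    simp only [hp] at h5
    linarith
  · push Not at hex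
    have h1 : Tendsto S atTop (𝓝 k) := hk.tendsto_sum_nat
    have h2 : Tendsto S atTop (𝓝 0) := by
      refine squeeze_zero_norm hex ?_
      simpa using (tendsto_pow_atTop_nhds_zero_of_lt_one hr0.le hr1).const_mul (1 - r)
    exact ⟨0, le_rfl, by simp [tendsto_nhds_unique h1 h2]⟩

/-- An approximately unital closed subalgebra of `C(K)` has an approximate identity in its unit
ball whose values lie in a narrow sector around the positive real axis. -/
theorem IsUniformAlgebra.exists_sectorial (hA : IsUniformAlgebra A) (F : Finset A) {ε : ℝ}
    (hε : 0 < ε) :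
    ∃ e : A, ‖e‖ ≤ 1 ∧ (∀ a ∈ F, ‖e * a - a‖ ≤ ε) ∧
      ∀ x : K, ∃ ρ : ℝ, 0 ≤ ρ ∧ ‖(e : C(K, ℂ)) x - ρ‖ ≤ ε * ρ := by
  obtain ⟨r, hr0, hr1, hr⟩ : ∃ r : ℝ, 0 < r ∧ r < 1 ∧ 3 * (1 - r) / r ≤ ε := by
    -- This `r` solves `3 * (1 - r) / r = ε`.
    refine ⟨3 / (3 + ε), by positivity, ?_, ?_⟩
    · rw [div_lt_one (by positivity)]; linarith
    · rw [div_le_iff₀ (by positivity)]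
      field_simp
      linarith
  have h1r : 0 < 1 - r := by linarith
  obtain ⟨e, he⟩ := hA.approximatelyUnital.exists_seq F hε
    (fun j => (((1 - r) * r ^ j : ℝ) : ℂ)) (fun n => (1 - r) * ((1 - r) * r ^ n))
    (fun n => by positivity)
  have hgeo : HasSum (fun j => (1 - r) * r ^ j) 1 := by
    have := (hasSum_geometric_of_lt_one hr0.le hr1).mul_left (1 - r)
    rwa [mul_inv_cancel₀ h1r.ne'] at this
  have hbd : ∀ j, ‖(((1 - r) * r ^ j : ℝ) : ℂ) • (e j : C(K, ℂ))‖ ≤ (1 - r) * r ^ j := fun j => by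
    rw [norm_smul, Complex.norm_of_nonneg (by positivity)]
    exact mul_le_of_le_one_right (by positivity) (he j).1
  have hsum : Summable fun j => (((1 - r) * r ^ j : ℝ) : ℂ) • (e j : C(K, ℂ)) :=
    Summable.of_norm_bounded hgeo.summable hbd
  obtain ⟨k, hk⟩ := hsum
  have hkA : k ∈ A := hA.isClosed.mem_of_tendsto hk.tendsto_sum_nat
    (Eventually.of_forall fun n => sum_mem fun j _ => A.smul_mem' _ (e j).2)
  refine ⟨⟨k, hkA⟩, ?_, fun a ha => ?_, fun x => ?_⟩
  · change ‖k‖ ≤ 1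
    rw [← hk.tsum_eq]
    exact tsum_of_norm_bounded hgeo hbd
  · change ‖k * (a : C(K, ℂ)) - a‖ ≤ ε
    have h1 : HasSum (fun j => ((((1 - r) * r ^ j : ℝ) : ℂ) • (e j : C(K, ℂ))) * (a : C(K, ℂ))
        - (((1 - r) * r ^ j : ℝ) : ℂ) • (a : C(K, ℂ))) (k * (a : C(K, ℂ)) - a) := by
      refine (hk.mul_right (a : C(K, ℂ))).sub ?_
      have : HasSum (fun j => (((1 - r) * r ^ j : ℝ) : ℂ)) ((1 : ℝ) : ℂ) := Complex.hasSum_ofReal.2 hgeo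
      simpa using this.smul_const (a : C(K, ℂ))
    rw [← h1.tsum_eq, ← mul_one ε]
    refine tsum_of_norm_bounded (hgeo.mul_left ε) fun j => ?_
    rw [smul_mul_assoc, ← smul_sub, norm_smul, Complex.norm_of_nonneg (by positivity), mul_comm]
    exact mul_le_mul_of_nonneg_right ((he j).2.1 a ha) (by positivity)
  · have hx : HasSum (fun j => (((1 - r) * r ^ j : ℝ) : ℂ) * (e j : C(K, ℂ)) x) (k x) :=
      ContinuousMap.hasSum_apply hk x
    obtain ⟨ρ, hρ, h⟩ := exists_norm_sub_le_of_hasSum hr0 hr1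
      (fun n => (norm_apply_le (e n) x).trans (he n).1) hx (fun n i hi => by
        have h1 := (norm_apply_le _ x).trans ((he n).2.2 i hi)
        have h2 : ((∑ j ∈ Finset.range i, (((1 - r) * r ^ j : ℝ) : ℂ) • e j : A) : C(K, ℂ)) x
          = ∑ j ∈ Finset.range i, (((1 - r) * r ^ j : ℝ) : ℂ) * (e j : C(K, ℂ)) x := by
          rw [AddSubmonoidClass.coe_finsetSum, ContinuousMap.sum_apply]; rfl
        rw [← h2, ← norm_mul, sub_mul, one_mul]
        exact h1)
    exact ⟨ρ, hρ, h.trans (mul_le_mul_of_nonneg_right hr hρ)⟩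

end UniformAlg
-- Minimal boundaries, peaking elements and Möbius transforms.
namespace UniformAlg

variable {K : Type*} [TopologicalSpace K] [CompactSpace K] {A : NonUnitalSubalgebra ℂ C(K, ℂ)}

theorem mul_pow_mem {K : Type*} [TopologicalSpace K] {A : NonUnitalSubalgebra ℂ C(K, ℂ)} {b v : C(K, ℂ)} (hb : b ∈ A) (hv : v ∈ A) (n : ℕ) : b * v ^ n ∈ A := by
  induction n with
  | zero => simpa using hb
  | succ n ih => rw [pow_succ, ← mul_assoc]; exact A.mul_mem' ih hv

/-- A closed subalgebra is stable under power series in an element times another element. -/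
theorem mul_mem_of_hasSum (hA : IsClosed (A : Set C(K, ℂ))) {b v s : C(K, ℂ)} (hb : b ∈ A)
    (hv : v ∈ A) {c : ℕ → ℂ} (hs : HasSum (fun n => c n • v ^ n) s) : b * s ∈ A := by
  refine hA.mem_of_tendsto (hs.mul_left b).tendsto_sum_nat
    (Eventually.of_forall fun n => sum_mem fun j _ => ?_)
  rw [mul_smul_comm]
  exact A.smul_mem' _ (mul_pow_mem hb hv j)

theorem exp_apply (v : C(K, ℂ)) (x : K) : (NormedSpace.exp v) x = Complex.exp (v x) := by
  have h1 := ContinuousMap.hasSum_apply (NormedSpace.exp_series_hasSum_exp' (𝕂 := ℂ) v) x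
  have h2 := NormedSpace.exp_series_hasSum_exp' (𝕂 := ℂ) (v x)
  rw [← Complex.exp_eq_exp_ℂ] at h2
  exact h1.unique h2

theorem mul_exp_mem (hA : IsClosed (A : Set C(K, ℂ))) {b v : C(K, ℂ)} (hb : b ∈ A)
    (hv : v ∈ A) : b * NormedSpace.exp v ∈ A :=
  mul_mem_of_hasSum hA hb hv (NormedSpace.exp_series_hasSum_exp' (𝕂 := ℂ) v)

/-- A closed set is a *boundary* for `A` if it is norming for `A`. -/
def IsBoundary (A : NonUnitalSubalgebra ℂ C(K, ℂ)) (E : Set K) : Prop :=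
  IsClosed E ∧ ∀ (f : A) (z : K), ∃ x ∈ E, ‖(f : C(K, ℂ)) z‖ ≤ ‖(f : C(K, ℂ)) x‖

theorem exists_minimal_isBoundary (A : NonUnitalSubalgebra ℂ C(K, ℂ)) :
    ∃ E : Set K, Minimal (IsBoundary A) E := by
  refine zorn_superset {E | IsBoundary A E} fun c hc hchain => ?_
  rcases c.eq_empty_or_nonempty with rfl | hne
  · exact ⟨Set.univ, ⟨isClosed_univ, fun f z => ⟨z, trivial, le_rfl⟩⟩, by simp⟩
  refine ⟨⋂₀ c, ⟨isClosed_sInter fun s hs => (hc hs).1, fun f z => ?_⟩,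
    fun s hs => Set.sInter_subset_of_mem hs⟩
  have hcl : IsClosed {x | ‖(f : C(K, ℂ)) z‖ ≤ ‖(f : C(K, ℂ)) x‖} :=
    isClosed_le continuous_const (by fun_prop)
  have : Nonempty c := hne.to_subtype
  obtain ⟨x, hx⟩ := IsCompact.nonempty_iInter_of_directed_nonempty_isCompact_isClosed
    (fun s : c => (s : Set K) ∩ {x | ‖(f : C(K, ℂ)) z‖ ≤ ‖(f : C(K, ℂ)) x‖})
    (by
      intro s t
      rcases hchain.total s.2 t.2 with h | h
      · exact ⟨s, subset_rfl, Set.inter_subset_inter_left _ h⟩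
      · exact ⟨t, Set.inter_subset_inter_left _ h, subset_rfl⟩)
    (fun s => by
      obtain ⟨x, hx, h⟩ := (hc s.2).2 f z
      exact ⟨x, hx, h⟩)
    (fun s => ((hc s.2).1.inter hcl).isCompact)
    (fun s => (hc s.2).1.inter hcl)
  rw [Set.mem_iInter] at hx
  exact ⟨x, fun s hs => (hx ⟨s, hs⟩).1, (hx ⟨_, hne.some_mem⟩).2⟩

theorem IsBoundary.norm_le {E : Set K} (hE : IsBoundary A E) {a : A} {M : ℝ} (hM : 0 ≤ M)
    (h : ∀ x ∈ E, ‖(a : C(K, ℂ)) x‖ ≤ M) : ‖a‖ ≤ M :=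
  norm_le_of_apply hM fun z => by
    obtain ⟨x, hx, hz⟩ := hE.2 a z
    exact hz.trans (h x hx)

theorem exists_pow_normalized {f : A} {y : K} {M : ℝ} (hM : ‖(f : C(K, ℂ)) y‖ = M)
    (hM0 : 0 < M) (hmax : ∀ z, ‖(f : C(K, ℂ)) z‖ ≤ M) (N : ℕ) :
    ∃ h : A, (h : C(K, ℂ)) y = 1 ∧ ‖h‖ ≤ 1 ∧
      ∀ z, ‖(h : C(K, ℂ)) z‖ = (‖(f : C(K, ℂ)) z‖ / M) ^ (N + 1) := by
  have hy0 : (f : C(K, ℂ)) y ≠ 0 := norm_pos_iff.1 (hM ▸ hM0)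
  have hmem : (f : C(K, ℂ)) ^ (N + 1) ∈ A := by
    rw [pow_succ']; exact mul_pow_mem f.2 f.2 N
  have hz : ∀ z, ‖(((f : C(K, ℂ)) y ^ (N + 1))⁻¹ • (f : C(K, ℂ)) ^ (N + 1)) z‖
      = (‖(f : C(K, ℂ)) z‖ / M) ^ (N + 1) := fun z => by
    rw [ContinuousMap.smul_apply, ContinuousMap.pow_apply, smul_eq_mul, norm_mul, norm_inv,
      norm_pow, norm_pow, hM, div_pow, div_eq_inv_mul]
  refine ⟨⟨_, A.smul_mem' (((f : C(K, ℂ)) y ^ (N + 1))⁻¹) hmem⟩, ?_, ?_, hz⟩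
  · change ((f : C(K, ℂ)) y ^ (N + 1))⁻¹ • ((f : C(K, ℂ)) ^ (N + 1)) y = 1
    rw [ContinuousMap.pow_apply, smul_eq_mul, inv_mul_cancel₀ (pow_ne_zero _ hy0)]
  · refine norm_le_of_apply zero_le_one fun z => ?_
    change ‖(((f : C(K, ℂ)) y ^ (N + 1))⁻¹ • (f : C(K, ℂ)) ^ (N + 1)) z‖ ≤ 1
    rw [hz]
    exact pow_le_one₀ (by positivity) ((div_le_one hM0).2 (hmax z))

/-- Each relatively open subset of a minimal boundary contains a point at which an element of
`A` nearly peaks. -/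
theorem exists_peaking {E : Set K} (hE : Minimal (IsBoundary A) E) (hne : ∃ a : A, a ≠ 0)
    {x : K} (hx : x ∈ E) {U : Set K} (hU : IsOpen U) (hxU : x ∈ U) {η : ℝ} (hη : 0 < η) :
    ∃ y ∈ E, y ∈ U ∧ ∃ h : A, (h : C(K, ℂ)) y = 1 ∧ ‖h‖ ≤ 1 ∧
      ∀ z ∈ E, z ∉ U → ‖(h : C(K, ℂ)) z‖ ≤ η := by
  have hcl : IsClosed (E \ U) := hE.prop.1.sdiff hU
  obtain ⟨f, z0, hf, hz0⟩ : ∃ (f : A) (z0 : K),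
      (∀ z ∈ E \ U, ‖(f : C(K, ℂ)) z‖ < ‖(f : C(K, ℂ)) z0‖) ∧ 0 < ‖(f : C(K, ℂ)) z0‖ := by
    rcases (E \ U).eq_empty_or_nonempty with h | ⟨z, hz⟩
    · obtain ⟨a, ha⟩ := hne
      obtain ⟨z0, hz0⟩ : ∃ z0, (a : C(K, ℂ)) z0 ≠ 0 := by
        by_contra hc
        push Not at hc
        exact ha (Subtype.ext (ContinuousMap.ext hc))
      exact ⟨a, z0, by simp [h], norm_pos_iff.2 hz0⟩
    · have hn : ¬ IsBoundary A (E \ U) := fun h =>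
        (hE.le_of_le h Set.sdiff_subset hx).2 hxU
      simp only [IsBoundary, hcl, true_and] at hn
      push Not at hn
      obtain ⟨f, z0, hf⟩ := hn
      exact ⟨f, z0, hf, (norm_nonneg _).trans_lt (hf z hz)⟩
  obtain ⟨y, hyE, hy⟩ := hE.prop.1.isCompact.exists_isMaxOn ⟨x, hx⟩
    (f := fun x => ‖(f : C(K, ℂ)) x‖) (by fun_prop)
  have hmax : ∀ z, ‖(f : C(K, ℂ)) z‖ ≤ ‖(f : C(K, ℂ)) y‖ := fun z => by
    obtain ⟨x', hx', h⟩ := hE.prop.2 f z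
    exact h.trans (hy hx')
  have hM : 0 < ‖(f : C(K, ℂ)) y‖ := hz0.trans_le (hmax z0)
  have hyU : y ∈ U := by
    by_contra h
    exact absurd (hf y ⟨hyE, h⟩) (not_lt.2 (hmax z0))
  obtain ⟨q, hq0, hq, hqM⟩ : ∃ q, 0 ≤ q ∧ (∀ z ∈ E \ U, ‖(f : C(K, ℂ)) z‖ ≤ q) ∧
      q < ‖(f : C(K, ℂ)) y‖ := by
    rcases (E \ U).eq_empty_or_nonempty with h | h
    · exact ⟨0, le_rfl, by simp [h], hM⟩
    · obtain ⟨z, hz, hz'⟩ := hcl.isCompact.exists_isMaxOn h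
        (f := fun x => ‖(f : C(K, ℂ)) x‖) (by fun_prop)
      exact ⟨_, norm_nonneg _, fun z hz => hz' hz, (hf z hz).trans_le (hmax z0)⟩
  obtain ⟨N, hN⟩ := exists_pow_lt_of_lt_one hη ((div_lt_one hM).2 hqM)
  obtain ⟨h, h1, h2, h3⟩ := exists_pow_normalized rfl hM hmax N
  refine ⟨y, hyE, hyU, h, h1, h2, fun z hz hzU => ?_⟩
  rw [h3]
  calc _ ≤ (q / ‖(f : C(K, ℂ)) y‖) ^ (N + 1) := by gcongr; exact hq z ⟨hz, hzU⟩
    _ ≤ (q / ‖(f : C(K, ℂ)) y‖) ^ N :=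
      pow_le_pow_of_le_one (by positivity) ((div_le_one hM).2 hqM.le) (Nat.le_succ N)
    _ ≤ η := hN.le

/-- A lower bound for the real part passes from a boundary to all points where `A` does not
vanish. -/
theorem IsBoundary.le_re {E : Set K} (hE : IsBoundary A E) (hA : IsClosed (A : Set C(K, ℂ)))
    {c : ℂ} {v : A} {s : ℝ} (h : ∀ x ∈ E, s ≤ (c + (v : C(K, ℂ)) x).re) {b : A} {z : K}
    (hb : (b : C(K, ℂ)) z ≠ 0) : s ≤ (c + (v : C(K, ℂ)) z).re := by
  by_contra! hlt
  set d := s - (c + (v : C(K, ℂ)) z).re with hd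
  have hd0 : 0 < d := by linarith
  -- Test the boundary on `b * exp (-n v)`; the factor `b` keeps it in `A`, which need not contain
  -- `exp (-n v)` itself. If the bound failed at `z` by `d`, this would grow like `exp (n d)` at `z`
  -- relative to its bound on `E`.
  have key : ∀ n : ℕ, ‖(b : C(K, ℂ)) z‖ * Real.exp (n * d) ≤ ‖b‖ := by
    intro n
    have hmem : (b : C(K, ℂ)) * NormedSpace.exp ((-n : ℂ) • (v : C(K, ℂ))) ∈ A :=
      mul_exp_mem hA b.2 (A.smul_mem' _ v.2)
    obtain ⟨x, hx, hle⟩ := hE.2 ⟨_, hmem⟩ z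
    simp only [ContinuousMap.mul_apply, exp_apply, ContinuousMap.smul_apply, norm_mul,
      Complex.norm_exp, smul_eq_mul] at hle
    have hre : ∀ x, ((-n : ℂ) * (v : C(K, ℂ)) x).re = -(n * ((v : C(K, ℂ)) x).re) := fun x => by
      simp
    rw [hre, hre] at hle
    have h1 := h x hx
    rw [Complex.add_re] at h1 hd
    have h2 : Real.exp (-(n * ((v : C(K, ℂ)) x).re)) ≤ Real.exp (-(n * (s - c.re))) := by
      refine Real.exp_le_exp.2 (neg_le_neg (mul_le_mul_of_nonneg_left ?_ n.cast_nonneg))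
      linarith
    have h3 : Real.exp (-(n * ((v : C(K, ℂ)) z).re))
        = Real.exp (n * d) * Real.exp (-(n * (s - c.re))) := by
      rw [← Real.exp_add]; congr 1; rw [hd]; ring
    rw [h3, ← mul_assoc] at hle
    refine le_of_mul_le_mul_right (hle.trans ?_) (Real.exp_pos (-(n * (s - c.re))))
    exact mul_le_mul (norm_apply_le b x) h2 (Real.exp_pos _).le (norm_nonneg _)
  have hb' : 0 < ‖(b : C(K, ℂ)) z‖ := norm_pos_iff.2 hb
  obtain ⟨n, hn⟩ := exists_nat_gt (‖b‖ / ‖(b : C(K, ℂ)) z‖ / d)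
  rw [div_lt_iff₀ hd0, div_lt_iff₀ hb'] at hn
  have h1 := key n
  have h2 := Real.add_one_le_exp (n * d)
  nlinarith

/-- Here `w - r = (h - r) / (1 - r h)` is the disc automorphism applied to `h`, and `(1 - r ^ 2) /
(1 - r) = 1 + r ≤ 2`. -/
theorem moebius_bounds {h w : ℂ} {r : ℝ} (hh : ‖h‖ ≤ 1) (hr0 : 0 < r) (hr1 : r < 1)
    (hw : w * (1 - r * h) = (1 - r ^ 2) * h) :
    ‖w - r‖ ≤ 1 ∧ (h = 1 → w = 1 + r) ∧ ‖w‖ ≤ 2 * ‖h‖ := by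
  have hD : 1 - r ≤ ‖1 - r * h‖ := by
    have h1 : ‖(r : ℂ) * h‖ ≤ r := by
      rw [norm_mul, Complex.norm_of_nonneg hr0.le]
      exact mul_le_of_le_one_right hr0.le hh
    have h2 := norm_sub_norm_le (1 : ℂ) (r * h)
    rw [norm_one] at h2
    linarith
  have hD0 : 0 < ‖1 - r * h‖ := by linarith
  refine ⟨?_, ?_, ?_⟩
  · have h1 : (w - r) * (1 - r * h) = h - r := by linear_combination hw
    have h2 : ‖h - r‖ ≤ ‖1 - r * h‖ := by
      refine le_of_sq_le_sq ?_ hD0.le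
      have h3 : ‖h‖ ^ 2 ≤ 1 := pow_le_one₀ (norm_nonneg _) hh
      rw [← Complex.normSq_eq_norm_sq, Complex.normSq_apply] at h3 ⊢
      rw [← Complex.normSq_eq_norm_sq, Complex.normSq_apply]
      simp only [Complex.sub_re, Complex.sub_im, Complex.ofReal_re, Complex.ofReal_im,
        Complex.one_re, Complex.one_im, Complex.re_ofReal_mul, Complex.im_ofReal_mul]
      have h4 : 0 ≤ (1 - r ^ 2) * (1 - (h.re * h.re + h.im * h.im)) :=
        mul_nonneg (by nlinarith) (by linarith)
      linarith
    rw [← h1, norm_mul] at h2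
    exact le_of_mul_le_mul_right (by linarith) hD0
  · rintro rfl
    have h1 : (1 - r : ℂ) ≠ 0 := by
      have : ((1 - r : ℝ) : ℂ) ≠ 0 := by exact_mod_cast (by linarith : (1 - r) ≠ 0)
      simpa using this
    refine mul_right_cancel₀ h1 ?_
    linear_combination hw
  · have h1 := congrArg norm hw
    have h2 : ((1 : ℂ) - r ^ 2) = ((1 - r ^ 2 : ℝ) : ℂ) := by simp
    rw [h2, norm_mul, norm_mul, Complex.norm_of_nonneg (by nlinarith)] at h1
    have h3 : ‖w‖ * (1 - r) ≤ (1 + r) * ‖h‖ * (1 - r) := by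
      calc _ ≤ ‖w‖ * ‖1 - r * h‖ := by gcongr
        _ = _ := by rw [h1]; ring
    have h4 := le_of_mul_le_mul_right h3 (by linarith)
    nlinarith [norm_nonneg h]

/-- A Möbius transform of an element of the unit ball: its translate by `-r` lies in the unit
ball of `C(K)`, and it is `1 + r` where the element is `1`. -/
theorem exists_moebius (hA : IsClosed (A : Set C(K, ℂ))) {h : A} (hh : ‖h‖ ≤ 1) {r : ℝ}
    (hr0 : 0 < r) (hr1 : r < 1) :
    ∃ w : A, ∀ z, ‖(w : C(K, ℂ)) z - r‖ ≤ 1 ∧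
      ((h : C(K, ℂ)) z = 1 → (w : C(K, ℂ)) z = 1 + r) ∧
      ‖(w : C(K, ℂ)) z‖ ≤ 2 * ‖(h : C(K, ℂ)) z‖ := by
  have hlt : ‖(r : ℂ) • (h : C(K, ℂ))‖ < 1 := by
    rw [norm_smul, Complex.norm_of_nonneg hr0.le]
    exact (mul_le_of_le_one_right hr0.le hh).trans_lt hr1
  have hsum := (summable_geometric_of_norm_lt_one hlt).hasSum
  have hinv := geom_series_mul_neg _ hlt
  set s := ∑' n : ℕ, ((r : ℂ) • (h : C(K, ℂ))) ^ n
  have hs : (h : C(K, ℂ)) * s ∈ A := by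
    refine mul_mem_of_hasSum hA h.2 h.2 (c := fun n => (r : ℂ) ^ n) ?_
    simpa only [smul_pow] using hsum
  refine ⟨⟨_, A.smul_mem' (1 - (r : ℂ) ^ 2) hs⟩, fun z =>
    moebius_bounds ((norm_apply_le h z).trans hh) hr0 hr1 ?_⟩
  have hz := congrArg (fun f : C(K, ℂ) => f z) hinv
  simp only [ContinuousMap.mul_apply, ContinuousMap.sub_apply, ContinuousMap.one_apply,
    ContinuousMap.smul_apply, smul_eq_mul] at hz
  change (1 - (r : ℂ) ^ 2) * ((h : C(K, ℂ)) z * s z) * _ = _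
  linear_combination (1 - (r : ℂ) ^ 2) * (h : C(K, ℂ)) z * hz

end UniformAlg
-- The projection is symmetric.
namespace UniformAlg

variable {K : Type*} [TopologicalSpace K] [CompactSpace K] {A : NonUnitalSubalgebra ℂ C(K, ℂ)}

theorem re_mul_nonneg_of_sector {e C : ℂ} {ρ ε : ℝ} (hρ : 0 ≤ ρ) (he : ‖e - ρ‖ ≤ ε * ρ)
    (hC : ε * ‖C‖ ≤ C.re) : 0 ≤ (e * C).re := by
  have h1 : e * C = ρ * C + (e - ρ) * C := by ring
  have h2 : |((e - ρ) * C).re| ≤ ε * ρ * ‖C‖ := by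
    refine (Complex.abs_re_le_norm _).trans ?_
    rw [norm_mul]
    gcongr
  rw [h1, Complex.add_re, Complex.re_ofReal_mul]
  have h3 := neg_abs_le ((e - ρ) * C).re
  nlinarith [mul_le_mul_of_nonneg_left hC hρ]

theorem IsContractive.norm_apply_le {T : A →ₗ[ℂ] A} (hT : IsContractive T) (a : A) (x : K) :
    ‖(T a : C(K, ℂ)) x‖ ≤ ‖a‖ :=
  (UniformAlg.norm_apply_le _ x).trans (hT a)

-- The core estimate. It is proved at a peaking point `y` near `x` and carried to `x` by continuity;
-- `e` stands in for the unit, `w` is the Möbius transform with `r = 1 - ε`, and `t` is the real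
-- part of `a y`.
set_option maxHeartbeats 1000000 in
theorem re_two_mul_sub_le_one (hA : IsUniformAlgebra A) {P : A →ₗ[ℂ] A}
    (hpos : IsRealPositiveMap P) (hbi : IsBicontractive P) {E : Set K}
    (hE : Minimal (IsBoundary A) E) (hne : ∃ a : A, a ≠ 0) {a : A} (ha : ‖a‖ ≤ 1) {x : K}
    (hx : x ∈ E) : (2 * (P a : C(K, ℂ)) x - (a : C(K, ℂ)) x).re ≤ 1 := by
  classical
  refine le_of_forall_pos_le_add fun ε' hε' => ?_
  obtain ⟨ε, hε, hε4, hεε'⟩ : ∃ ε : ℝ, 0 < ε ∧ ε ≤ 1 / 4 ∧ 27 * ε ≤ ε' :=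
    ⟨min (1 / 4) (ε' / 27), by positivity, min_le_left _ _, by
      have := min_le_right (1 / 4) (ε' / 27)
      linarith⟩
  set f : K → ℂ := fun z => 2 * (P a : C(K, ℂ)) z - (a : C(K, ℂ)) z with hf
  have hfc : Continuous f := by fun_prop
  set U : Set K := {z | ‖(a : C(K, ℂ)) z - (a : C(K, ℂ)) x‖ < ε} ∩ {z | ‖f z - f x‖ < ε}
  have hU : IsOpen U := (isOpen_lt (by fun_prop) continuous_const).inter
    (isOpen_lt (by fun_prop) continuous_const)
  have hxU : x ∈ U := by simp [U, hε]
  obtain ⟨y, hyE, hyU, h, hy1, hh, hoff⟩ :=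
    exists_peaking hE hne hx hU hxU (half_pos hε)
  obtain ⟨w, hw⟩ := exists_moebius hA.isClosed hh (r := 1 - ε) (by linarith) (by linarith)
  obtain ⟨e, he1, heF, hsec⟩ := hA.exists_sectorial {a, h} hε
  have hea := heF a (by simp)
  have heh := heF h (by simp)
  have hw2 : ∀ z, ‖(w : C(K, ℂ)) z‖ ≤ 2 := fun z =>
    (hw z).2.2.trans (by linarith [(UniformAlg.norm_apply_le h z).trans hh])
  have hey : ‖(e : C(K, ℂ)) y - 1‖ ≤ ε := by
    have := (UniformAlg.norm_apply_le _ y).trans heh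
    change ‖(e : C(K, ℂ)) y * (h : C(K, ℂ)) y - (h : C(K, ℂ)) y‖ ≤ ε at this
    simpa [hy1] using this
  set M := ((P e : C(K, ℂ)) y).re with hM
  set m := ((P (e * w) : C(K, ℂ)) y).re with hm
  set t := ((a : C(K, ℂ)) y).re with ht
  have hM1 : M ≤ 1 :=
    (Complex.re_le_norm _).trans ((hbi.1.norm_apply_le e y).trans he1)
  have hat : ∀ z, |((a : C(K, ℂ)) z).re| ≤ 1 := fun z =>
    (Complex.abs_re_le_norm _).trans ((UniformAlg.norm_apply_le a z).trans ha)
  have ht1 := abs_le.1 (hat y)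
  -- the mass near `y` dominates, by contractivity of `I - P`
  have hmM : (1 - ε) * M - ε ≤ m := by
    set b : A := e * w - (((1 - ε : ℝ) : ℂ)) • e with hb
    have hbz : ∀ z, (b : C(K, ℂ)) z
        = (e : C(K, ℂ)) z * ((w : C(K, ℂ)) z - ((1 - ε : ℝ) : ℂ)) := fun z => by
      change (e : C(K, ℂ)) z * (w : C(K, ℂ)) z - ((1 - ε : ℝ) : ℂ) * (e : C(K, ℂ)) z = _
      ring
    have hb1 : ‖b‖ ≤ 1 := norm_le_of_apply zero_le_one fun z => by
      rw [hbz, norm_mul]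
      exact mul_le_one₀ ((UniformAlg.norm_apply_le e z).trans he1) (norm_nonneg _) (hw z).1
    have h1 := (Complex.re_le_norm _).trans ((hbi.2.norm_apply_le b y).trans hb1)
    have hPb : P b = P (e * w) - (((1 - ε : ℝ) : ℂ)) • P e := by rw [hb, map_sub, map_smul]
    have h2 : (((LinearMap.id - P : A →ₗ[ℂ] A) b : A) : C(K, ℂ)) y
        = (b : C(K, ℂ)) y - ((P (e * w) : C(K, ℂ)) y
          - ((1 - ε : ℝ) : ℂ) * (P e : C(K, ℂ)) y) := by
      rw [LinearMap.sub_apply, hPb]; rfl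
    rw [h2, hbz, (hw y).2.1 hy1, add_sub_cancel_right, mul_one, Complex.sub_re, Complex.sub_re,
      Complex.re_ofReal_mul] at h1
    have h3 := (abs_le.1 ((Complex.abs_re_le_norm _).trans hey)).1
    rw [Complex.sub_re, Complex.one_re] at h3
    linarith
  -- positivity
  have hB : ∀ z ∈ E, -(4 * ε) ≤ (2 + ((-(2 : ℂ)) • a - ((1 - t : ℝ) : ℂ) • w : A).1 z).re := by
    intro z hz
    have hz0 : (2 + ((-(2 : ℂ)) • a - ((1 - t : ℝ) : ℂ) • w : A).1 z).re
        = 2 - 2 * ((a : C(K, ℂ)) z).re - (1 - t) * ((w : C(K, ℂ)) z).re := by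
      change (2 + (-(2 : ℂ) * (a : C(K, ℂ)) z - ((1 - t : ℝ) : ℂ) * (w : C(K, ℂ)) z)).re = _
      rw [Complex.add_re, Complex.sub_re, Complex.re_ofReal_mul]
      simp
      ring
    rw [hz0]
    have hwre := Complex.re_le_norm ((w : C(K, ℂ)) z)
    -- Inside `U`, `Re a` is within `2ε` of `t` and `Re w ≤ 2`, so the terms cancel up to `4ε`.
    -- Outside `U`, `‖w‖ ≤ ε` and `Re a ≤ 1`.
    by_cases hzU : z ∈ U
    · have h1 : ((a : C(K, ℂ)) z).re - t ≤ 2 * ε := by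
        have h2 : (a : C(K, ℂ)) z - (a : C(K, ℂ)) y = ((a : C(K, ℂ)) z - (a : C(K, ℂ)) x)
          - ((a : C(K, ℂ)) y - (a : C(K, ℂ)) x) := by ring
        have h3 := Complex.re_le_norm ((a : C(K, ℂ)) z - (a : C(K, ℂ)) y)
        rw [Complex.sub_re] at h3
        refine h3.trans ?_
        rw [h2]
        refine (norm_sub_le _ _).trans ?_
        have h4 : ‖(a : C(K, ℂ)) z - (a : C(K, ℂ)) x‖ < ε := hzU.1
        have h5 : ‖(a : C(K, ℂ)) y - (a : C(K, ℂ)) x‖ < ε := hyU.1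
        linarith
      nlinarith [hw2 z]
    · have h1 := hoff z hz hzU
      have h2 := (hw z).2.2
      have h3 := (abs_le.1 (hat z)).2
      nlinarith
  -- The slack must absorb the `4ε` above and the sector error `ε‖C‖ ≤ ε(8 + s)`; as `ε ≤ 1/4`, `16ε
  -- ≥ 13ε` suffices.
  set s : ℝ := 20 * ε with hs
  set G : A := ((2 + s : ℝ) : ℂ) • e - (2 : ℂ) • (e * a) - ((1 - t : ℝ) : ℂ) • (e * w) with hG
  have hGpos : IsRealPositive G := by
    intro z
    set C : ℂ := ((2 + s : ℝ) : ℂ) - 2 * (a : C(K, ℂ)) z - ((1 - t : ℝ) : ℂ) * (w : C(K, ℂ)) z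
      with hC
    have hGz : (G : C(K, ℂ)) z = (e : C(K, ℂ)) z * C := by
      change ((2 + s : ℝ) : ℂ) * (e : C(K, ℂ)) z - 2 * ((e : C(K, ℂ)) z * (a : C(K, ℂ)) z)
        - ((1 - t : ℝ) : ℂ) * ((e : C(K, ℂ)) z * (w : C(K, ℂ)) z) = _
      ring
    rw [hGz]
    by_cases hez : (e : C(K, ℂ)) z = 0
    · rw [hez, zero_mul, Complex.zero_re]
    obtain ⟨ρ, hρ, hρe⟩ := hsec z
    refine re_mul_nonneg_of_sector hρ hρe ?_
    have h1 := hE.prop.le_re hA.isClosed hB hez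
    have h2 : C = s + (2 + ((-(2 : ℂ)) • a - ((1 - t : ℝ) : ℂ) • w : A).1 z) := by
      change _ = (s : ℂ) + (2 + (-(2 : ℂ) * (a : C(K, ℂ)) z
        - ((1 - t : ℝ) : ℂ) * (w : C(K, ℂ)) z))
      rw [hC]; push_cast; ring
    have h3 : s - 4 * ε ≤ C.re := by
      rw [h2, Complex.add_re, Complex.ofReal_re]; linarith
    have h4 : ‖C‖ ≤ 8 + s := by
      rw [hC]
      refine (norm_sub_le _ _).trans ((add_le_add_left (norm_sub_le _ _) _).trans ?_)
      rw [norm_mul, norm_mul, Complex.norm_of_nonneg (by positivity),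
        Complex.norm_of_nonneg (by linarith)]
      have h5 := (UniformAlg.norm_apply_le a z).trans ha
      simp only [Complex.norm_ofNat]
      nlinarith [hw2 z]
    nlinarith
  have hPG := hpos G hGpos y
  have hPGv : P G = ((2 + s : ℝ) : ℂ) • P e - (2 : ℂ) • P (e * a)
      - ((1 - t : ℝ) : ℂ) • P (e * w) := by
    rw [hG, map_sub, map_sub, map_smul, map_smul, map_smul]
  have hPGy : (P G : C(K, ℂ)) y = ((2 + s : ℝ) : ℂ) * (P e : C(K, ℂ)) y
      - ((2 : ℝ) : ℂ) * (P (e * a) : C(K, ℂ)) y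
      - ((1 - t : ℝ) : ℂ) * (P (e * w) : C(K, ℂ)) y := by
    rw [hPGv, Complex.ofReal_ofNat]; rfl
  rw [hPGy, Complex.sub_re, Complex.sub_re, Complex.re_ofReal_mul, Complex.re_ofReal_mul,
    Complex.re_ofReal_mul] at hPG
  have hPea : ((P a : C(K, ℂ)) y).re ≤ ((P (e * a) : C(K, ℂ)) y).re + ε := by
    have h1 := (hbi.1.norm_apply_le (e * a - a) y).trans hea
    rw [map_sub] at h1
    have h2 := (abs_le.1 ((Complex.abs_re_le_norm _).trans h1)).1
    change -ε ≤ ((P (e * a) : C(K, ℂ)) y - (P a : C(K, ℂ)) y).re at h2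
    rw [Complex.sub_re] at h2
    linarith
  have hfy : (f y).re = 2 * ((P a : C(K, ℂ)) y).re - t := by simp [hf, ht]
  have hfxy : (f x).re ≤ (f y).re + ε := by
    have h1 : ‖f y - f x‖ < ε := hyU.2
    have h2 := (abs_le.1 ((Complex.abs_re_le_norm _).trans h1.le)).1
    rw [Complex.sub_re] at h2
    linarith
  have hfin : 2 * ((P a : C(K, ℂ)) y).re ≤ 1 + t + 26 * ε := by
    nlinarith [mul_le_mul_of_nonneg_left hmM (by linarith : (0 : ℝ) ≤ 1 - t),
      mul_le_mul_of_nonneg_left hM1 (by linarith : (0 : ℝ) ≤ 1 + t),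
      mul_le_mul_of_nonneg_left hM1 (mul_nonneg hε.le (by linarith : (0 : ℝ) ≤ 1 - t)),
      mul_le_mul_of_nonneg_left hM1 hε.le]
  linarith

theorem isSymmetricProj (hA : IsUniformAlgebra A) {P : A →ₗ[ℂ] A}
    (hpos : IsRealPositiveMap P) (hbi : IsBicontractive P) : IsSymmetricProj P := by
  intro a
  by_cases ha0 : a = 0
  · rw [ha0, map_zero]
  obtain ⟨E, hE⟩ := exists_minimal_isBoundary A
  refine hE.prop.norm_le (norm_nonneg a) fun x hx => ?_
  have hna : 0 < ‖a‖ := norm_pos_iff.2 ha0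
  have hval : (((LinearMap.id - (2 : ℂ) • P : A →ₗ[ℂ] A) a : A) : C(K, ℂ)) x
      = (a : C(K, ℂ)) x - 2 * (P a : C(K, ℂ)) x := rfl
  rw [hval, norm_sub_rev]
  set v := 2 * (P a : C(K, ℂ)) x - (a : C(K, ℂ)) x with hv
  obtain ⟨θ, hθ, hθv⟩ : ∃ θ : ℂ, ‖θ‖ ≤ 1 ∧ θ * v = ‖v‖ := by
    by_cases hv0 : v = 0
    · exact ⟨0, by simp, by simp [hv0]⟩
    · have hn : (‖v‖ : ℂ) ≠ 0 := by simpa using hv0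
      refine ⟨‖v‖ / v, ?_, div_mul_cancel₀ _ hv0⟩
      rw [norm_div, Complex.norm_real, norm_norm, div_self (norm_ne_zero_iff.2 hv0)]
  set q : ℂ := ((‖a‖⁻¹ : ℝ) : ℂ) * θ with hq
  have hqa : ‖q • a‖ ≤ 1 := by
    change ‖q • (a : C(K, ℂ))‖ ≤ 1
    rw [norm_smul, hq, norm_mul, Complex.norm_of_nonneg (by positivity)]
    change ‖a‖⁻¹ * ‖θ‖ * ‖a‖ ≤ 1
    rw [mul_right_comm, inv_mul_cancel₀ hna.ne', one_mul]
    exact hθ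
  have h1 := re_two_mul_sub_le_one hA hpos hbi hE ⟨a, ha0⟩ hqa hx
  rw [map_smul] at h1
  change (2 * (q * (P a : C(K, ℂ)) x) - q * (a : C(K, ℂ)) x).re ≤ 1 at h1
  have h2 : 2 * (q * (P a : C(K, ℂ)) x) - q * (a : C(K, ℂ)) x
      = ((‖a‖⁻¹ * ‖v‖ : ℝ) : ℂ) := by
    rw [Complex.ofReal_mul, ← hθv, hq, hv]; ring
  rw [h2, Complex.ofReal_re, inv_mul_le_iff₀ hna, mul_one] at h1
  exact h1

end UniformAlg
-- Isometric involutions and their local multiplicativity.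
namespace UniformAlg

variable {K : Type*} [TopologicalSpace K] [CompactSpace K] {A : NonUnitalSubalgebra ℂ C(K, ℂ)}

theorem exists_norm_mul_add_eq (u v : ℂ) : ∃ α : ℂ, ‖α‖ ≤ 1 ∧ ‖α * u + v‖ = ‖u‖ + ‖v‖ := by
  by_cases hu : u = 0
  · exact ⟨1, by simp, by simp [hu]⟩
  by_cases hv : v = 0
  · exact ⟨1, by simp, by simp [hv]⟩
  have hu' : (‖u‖ : ℂ) ≠ 0 := by simpa using hu
  have hv' : (‖v‖ : ℂ) ≠ 0 := by simpa using hv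
  refine ⟨v / ‖v‖ * (‖u‖ / u), ?_, ?_⟩
  · rw [norm_mul, norm_div, norm_div, Complex.norm_real, Complex.norm_real, norm_norm, norm_norm,
      div_self (norm_ne_zero_iff.2 hv), div_self (norm_ne_zero_iff.2 hu), one_mul]
  · have h : v / ‖v‖ * (‖u‖ / u) * u + v = v / ‖v‖ * ((‖u‖ + ‖v‖ : ℝ) : ℂ) := by
      push_cast
      field_simp
    rw [h, norm_mul, norm_div, Complex.norm_real, norm_norm, div_self (norm_ne_zero_iff.2 hv),
      one_mul, Complex.norm_of_nonneg (by positivity)]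

/-- The map `z ↦ (z + z²)/2` has modulus near 1 on the closed disc only near `z = 1`: factor both
sides and use the parallelogram law for `1 ± z`. -/
theorem norm_one_sub_sq_le {z : ℂ} (hz : ‖z‖ ≤ 1) :
    ‖1 - (1 / 2 : ℂ) * (z + z * z)‖ ^ 2 ≤ 9 * (1 - ‖(1 / 2 : ℂ) * (z + z * z)‖ ^ 2) := by
  have h1 : (1 : ℂ) - (1 / 2 : ℂ) * (z + z * z) = (1 - z) * (1 + z / 2) := by ring
  have h2 : (1 / 2 : ℂ) * (z + z * z) = z * ((1 + z) / 2) := by ring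
  have h3 : ‖1 + z / 2‖ ≤ 3 / 2 := by
    refine (norm_add_le _ _).trans ?_
    rw [norm_one, norm_div, Complex.norm_ofNat]
    linarith
  have h4 : ‖1 - z‖ ^ 2 + ‖1 + z‖ ^ 2 ≤ 4 := by
    have := parallelogram_law_with_norm ℝ (1 : ℂ) z
    rw [norm_one] at this
    nlinarith [norm_nonneg z]
  have h5 : ‖1 - (1 / 2 : ℂ) * (z + z * z)‖ ^ 2 ≤ ‖1 - z‖ ^ 2 * (3 / 2) ^ 2 := by
    rw [h1, norm_mul, mul_pow]
    gcongr
  have h6 : ‖(1 / 2 : ℂ) * (z + z * z)‖ ^ 2 ≤ ‖1 + z‖ ^ 2 / 4 := by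
    rw [h2, norm_mul, norm_div, Complex.norm_ofNat, mul_pow, div_pow]
    have : ‖z‖ ^ 2 ≤ 1 := pow_le_one₀ (norm_nonneg _) hz
    nlinarith [sq_nonneg ‖1 + z‖]
  nlinarith

/-- Near a point of a minimal boundary there are a peaking element `H`, and a wider one `h`, which
is close to `1` wherever `H` is not small. -/
theorem exists_peaking_pair {E : Set K} (hE : Minimal (IsBoundary A) E) (hne : ∃ a : A, a ≠ 0)
    {x : K} (hx : x ∈ E) {U : Set K} (hU : IsOpen U) (hxU : x ∈ U) {δ : ℝ} (hδ : 0 < δ)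
    (hδ1 : δ ≤ 1) :
    ∃ y ∈ E, y ∈ U ∧ ∃ h H : A, (h : C(K, ℂ)) y = 1 ∧ (H : C(K, ℂ)) y = 1 ∧ ‖H‖ ≤ 1 ∧
      ∀ z ∈ E, ‖(H : C(K, ℂ)) z‖ ≤ 1 / 2 ∨ (z ∈ U ∧ ‖1 - (h : C(K, ℂ)) z‖ ≤ δ) := by
  obtain ⟨y, hyE, hyU, f, hfy, hf1, hoff⟩ :=
    exists_peaking hE hne hx hU hxU (η := 1 / 2) (by norm_num)
  set h : A := (1 / 2 : ℂ) • (f + f * f) with hh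
  have hz : ∀ z, (h : C(K, ℂ)) z
      = (1 / 2 : ℂ) * ((f : C(K, ℂ)) z + (f : C(K, ℂ)) z * (f : C(K, ℂ)) z) := fun z => rfl
  have hfz : ∀ z, ‖(f : C(K, ℂ)) z‖ ≤ 1 := fun z => (norm_apply_le f z).trans hf1
  have hle : ∀ z, ‖(h : C(K, ℂ)) z‖ ≤ ‖(f : C(K, ℂ)) z‖ := fun z => by
    rw [hz, norm_mul]
    have h1 : ‖(1 / 2 : ℂ)‖ = 1 / 2 := by simp
    have h2 := norm_add_le ((f : C(K, ℂ)) z) ((f : C(K, ℂ)) z * (f : C(K, ℂ)) z)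
    rw [norm_mul] at h2
    rw [h1]
    nlinarith [hfz z, norm_nonneg ((f : C(K, ℂ)) z)]
  have hhy : (h : C(K, ℂ)) y = 1 := by rw [hz, hfy]; norm_num
  -- Above this threshold `1 - ‖h‖² ≤ 2 (1 - ‖h‖) < δ² / 9`, so `norm_one_sub_sq_le` gives `‖1 - h‖
  -- ≤ δ`.
  have hq : 1 - δ ^ 2 / 18 < 1 := by have : 0 < δ ^ 2 := by positivity
                                     linarith
  have hq2 : 1 / 2 ≤ 1 - δ ^ 2 / 18 := by nlinarith
  obtain ⟨N, hN⟩ := exists_pow_lt_of_lt_one (show (0 : ℝ) < 1 / 2 by norm_num) hq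
  obtain ⟨H, H1, H2, H3⟩ := exists_pow_normalized (f := h) (y := y) (M := 1)
    (by rw [hhy, norm_one]) one_pos (fun z => (hle z).trans (hfz z)) N
  refine ⟨y, hyE, hyU, h, H, hhy, H1, H2, fun z hzE => ?_⟩
  by_cases hc : ‖(h : C(K, ℂ)) z‖ ≤ 1 - δ ^ 2 / 18
  · left
    rw [H3, div_one]
    calc _ ≤ (1 - δ ^ 2 / 18) ^ (N + 1) := by gcongr
      _ ≤ (1 - δ ^ 2 / 18) ^ N := pow_le_pow_of_le_one (by linarith) hq.le (Nat.le_succ N)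
      _ ≤ 1 / 2 := hN.le
  · right
    push Not at hc
    constructor
    · by_contra hzU
      linarith [hle z, hoff z hzE hzU]
    · have h1 := norm_one_sub_sq_le (hfz z)
      rw [← hz] at h1
      refine le_of_sq_le_sq ?_ hδ.le
      nlinarith

/-- Let `T` be an isometric involution and let `H` peak at `y`. If `F` is small wherever `H` is
not, then `T (b * T F)` is small at `y`. -/
theorem norm_apply_mul_apply_le {T : A →ₗ[ℂ] A} (hT : IsContractive T) (hTT : ∀ a, T (T a) = a)
    {E : Set K} (hE : IsBoundary A E) {y : K} {H F : A} (hHy : (H : C(K, ℂ)) y = 1)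
    (hH1 : ‖H‖ ≤ 1) {δ : ℝ} (hδ : 0 ≤ δ)
    (hF : ∀ z ∈ E, ‖(H : C(K, ℂ)) z‖ ≤ 1 / 2 ∨ ‖(F : C(K, ℂ)) z‖ ≤ δ) (b : A) :
    ‖(T (b * T F) : C(K, ℂ)) y‖ ≤ ‖b‖ * δ := by
  -- With this weight, `‖H‖ ≤ 1/2` leaves room `‖F‖` in `C`, enough to absorb `F`.
  set C : ℝ := 2 * ‖F‖ with hC
  have hC0 : 0 ≤ C := by positivity
  have hE1 : ∀ z ∈ E, ‖(F : C(K, ℂ)) z‖ + C * ‖(H : C(K, ℂ)) z‖ ≤ C + δ := by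
    intro z hz
    have h1 := norm_apply_le F z
    have h2 := (norm_apply_le H z).trans hH1
    rcases hF z hz with h | h
    · have := mul_le_mul_of_nonneg_left h hC0
      linarith
    · have := mul_le_mul_of_nonneg_left h2 hC0
      linarith
  -- A bound on `‖F‖ + C‖H‖` is a norm bound on all `α F + C H` with `‖α‖ ≤ 1`, so it passes through
  -- `T`. Multiplying by `b` and applying `T` again returns `H`, whose value 1 at `y` uses up the
  -- `C` term.
  have hK1 : ∀ z, ‖(T F : C(K, ℂ)) z‖ + C * ‖(T H : C(K, ℂ)) z‖ ≤ C + δ := by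
    intro z
    obtain ⟨α, hα, h⟩ := exists_norm_mul_add_eq ((T F : C(K, ℂ)) z) (C * (T H : C(K, ℂ)) z)
    have h1 : ‖α • F + (C : ℂ) • H‖ ≤ C + δ := hE.norm_le (by positivity) fun x hx => by
      change ‖α * (F : C(K, ℂ)) x + C * (H : C(K, ℂ)) x‖ ≤ _
      refine (norm_add_le _ _).trans (le_trans ?_ (hE1 x hx))
      rw [norm_mul, norm_mul, Complex.norm_of_nonneg hC0]
      gcongr
      exact mul_le_of_le_one_left (norm_nonneg _) hα
    have h2 := (hT.norm_apply_le _ z).trans h1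
    rw [map_add, map_smul, map_smul] at h2
    change ‖α * (T F : C(K, ℂ)) z + C * (T H : C(K, ℂ)) z‖ ≤ _ at h2
    rwa [h, norm_mul, Complex.norm_of_nonneg hC0] at h2
  obtain ⟨α, hα, h⟩ := exists_norm_mul_add_eq ((T (b * T F) : C(K, ℂ)) y) ((‖b‖ * C : ℝ) : ℂ)
  have h1 : ‖α • (b * T F) + ((‖b‖ * C : ℝ) : ℂ) • T H‖ ≤ ‖b‖ * (C + δ) :=
    norm_le_of_apply (by positivity) fun z => by
      change ‖α * ((b : C(K, ℂ)) z * (T F : C(K, ℂ)) z)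
        + ((‖b‖ * C : ℝ) : ℂ) * (T H : C(K, ℂ)) z‖ ≤ _
      refine (norm_add_le _ _).trans ?_
      rw [norm_mul, norm_mul, norm_mul, Complex.norm_of_nonneg (by positivity)]
      have h2 : ‖α‖ * (‖(b : C(K, ℂ)) z‖ * ‖(T F : C(K, ℂ)) z‖)
          ≤ ‖b‖ * ‖(T F : C(K, ℂ)) z‖ := by
        refine (mul_le_of_le_one_left (by positivity) hα).trans ?_
        gcongr
        exact norm_apply_le b z
      have h3 := mul_le_mul_of_nonneg_left (hK1 z) (norm_nonneg b)
      linarith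
  have h2 := (hT.norm_apply_le _ y).trans h1
  rw [map_add, map_smul, map_smul, hTT] at h2
  change ‖α * (T (b * T F) : C(K, ℂ)) y + ((‖b‖ * C : ℝ) : ℂ) * (H : C(K, ℂ)) y‖ ≤ _ at h2
  rw [hHy, mul_one, h, Complex.norm_of_nonneg (by positivity)] at h2
  linarith

/-- An isometric linear involution of a uniform algebra is a weighted composition operator, in
the following sense. -/
theorem apply_mul_apply_mul {T : A →ₗ[ℂ] A} (hT : IsContractive T) (hTT : ∀ a, T (T a) = a)
    (b c k : A) : T c * T (b * k) = T k * T (b * c) := by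
  by_cases hne : ∃ a : A, a ≠ 0
  swap
  · push Not at hne
    rw [hne (T c * T (b * k)), hne (T k * T (b * c))]
  obtain ⟨E, hE⟩ := exists_minimal_isBoundary A
  rw [← sub_eq_zero, ← norm_le_zero_iff]
  refine hE.prop.norm_le le_rfl fun x hx => ?_
  set D : A := T c * T (b * k) - T k * T (b * c) with hD
  have hDz : ∀ z, (D : C(K, ℂ)) z = (T c : C(K, ℂ)) z * (T (b * k) : C(K, ℂ)) z
      - (T k : C(K, ℂ)) z * (T (b * c) : C(K, ℂ)) z := fun z => rfl
  set Q : ℝ := 1 + ‖c‖ * (‖b‖ * (2 + ‖k‖)) + ‖k‖ * (‖b‖ * (2 + ‖c‖)) with hQ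
  have hQ0 : 0 < Q := by positivity
  have key : ∀ δ : ℝ, 0 < δ → δ ≤ 1 → ‖(D : C(K, ℂ)) x‖ ≤ Q * δ := by
    intro δ hδ hδ1
    set U : Set K := {z | ‖(D : C(K, ℂ)) z - (D : C(K, ℂ)) x‖ < δ} ∩
      ({z | ‖(T k : C(K, ℂ)) z - (T k : C(K, ℂ)) x‖ < δ} ∩
        {z | ‖(T c : C(K, ℂ)) z - (T c : C(K, ℂ)) x‖ < δ}) with hUdef
    have hU : IsOpen U := (isOpen_lt (by fun_prop) continuous_const).inter
      ((isOpen_lt (by fun_prop) continuous_const).inter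
        (isOpen_lt (by fun_prop) continuous_const))
    have hxU : x ∈ U := by simp [U, hδ]
    obtain ⟨y, hyE, hyU, h, H, hhy, hHy, hH1, hpk⟩ :=
      exists_peaking_pair hE hne hx hU hxU hδ hδ1
    have main : ∀ j : A, (∀ z ∈ U, ‖(T j : C(K, ℂ)) z - (T j : C(K, ℂ)) x‖ < δ) →
        ‖(T (b * j) : C(K, ℂ)) y - (T j : C(K, ℂ)) y * (T (b * T h) : C(K, ℂ)) y‖
          ≤ ‖b‖ * ((2 + ‖j‖) * δ) := by
      intro j hj
      -- Subtracting this multiple of `h` makes `F` small wherever `H` is not. Thus `T (b * j)` is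
      -- almost `T j` at `y` times a factor independent of `j`, and the two products in `D` agree.
      set F : A := T j - (T j : C(K, ℂ)) y • h with hF
      have hTF : T F = j - (T j : C(K, ℂ)) y • T h := by rw [hF, map_sub, map_smul, hTT]
      have h1 := norm_apply_mul_apply_le hT hTT hE.prop hHy hH1 (F := F) (δ := (2 + ‖j‖) * δ)
        (by positivity) (fun z hz => by
          refine (hpk z hz).imp_right fun ⟨hzU, hz1⟩ => ?_
          have h2 : (F : C(K, ℂ)) z = ((T j : C(K, ℂ)) z - (T j : C(K, ℂ)) x)
              - ((T j : C(K, ℂ)) y - (T j : C(K, ℂ)) x)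
              + (T j : C(K, ℂ)) y * (1 - (h : C(K, ℂ)) z) := by
            change (T j : C(K, ℂ)) z - (T j : C(K, ℂ)) y * (h : C(K, ℂ)) z = _
            ring
          have h3 : ‖(T j : C(K, ℂ)) y * (1 - (h : C(K, ℂ)) z)‖ ≤ ‖j‖ * δ := by
            rw [norm_mul]
            exact mul_le_mul (hT.norm_apply_le j y) hz1 (norm_nonneg _) (norm_nonneg _)
          rw [h2]
          refine (norm_add_le _ _).trans ((add_le_add (norm_sub_le _ _) h3).trans ?_)
          linarith [hj z hzU, hj y hyU]) b
      rw [hTF, mul_sub, mul_smul_comm, map_sub, map_smul] at h1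
      exact h1
    have hk := main k fun z hz => hz.2.1
    have hc := main c fun z hz => hz.2.2
    have hDy : (D : C(K, ℂ)) y = (T c : C(K, ℂ)) y * ((T (b * k) : C(K, ℂ)) y
        - (T k : C(K, ℂ)) y * (T (b * T h) : C(K, ℂ)) y)
        - (T k : C(K, ℂ)) y * ((T (b * c) : C(K, ℂ)) y
        - (T c : C(K, ℂ)) y * (T (b * T h) : C(K, ℂ)) y) := by rw [hDz]; ring
    have h4 : ‖(D : C(K, ℂ)) y‖ ≤ ‖c‖ * (‖b‖ * ((2 + ‖k‖) * δ))
        + ‖k‖ * (‖b‖ * ((2 + ‖c‖) * δ)) := by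
      rw [hDy]
      refine (norm_sub_le _ _).trans (add_le_add ?_ ?_)
      · rw [norm_mul]
        exact mul_le_mul (hT.norm_apply_le c y) hk (norm_nonneg _) (norm_nonneg _)
      · rw [norm_mul]
        exact mul_le_mul (hT.norm_apply_le k y) hc (norm_nonneg _) (norm_nonneg _)
    have h5 : ‖(D : C(K, ℂ)) y - (D : C(K, ℂ)) x‖ < δ := hyU.1
    have h6 := norm_sub_norm_le ((D : C(K, ℂ)) x) ((D : C(K, ℂ)) y)
    rw [norm_sub_rev] at h6
    rw [hQ]
    linarith
  refine le_of_forall_pos_le_add fun ε hε => ?_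
  have h1 := key (min 1 (ε / Q)) (by positivity) (min_le_left _ _)
  have h2 := mul_le_mul_of_nonneg_left (min_le_right 1 (ε / Q)) hQ0.le
  rw [mul_div_cancel₀ _ hQ0.ne'] at h2
  linarith

end UniformAlg
-- The pointwise dichotomy and the conditional expectation.
namespace UniformAlg

variable {K : Type*} [TopologicalSpace K] [CompactSpace K] {A : NonUnitalSubalgebra ℂ C(K, ℂ)}

theorem tendsto_apply {ι : Type*} {l : Filter ι} {f : ι → A} {a : A} (h : Tendsto f l (𝓝 a))
    (x : K) : Tendsto (fun i => (f i : C(K, ℂ)) x) l (𝓝 ((a : C(K, ℂ)) x)) := by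
  rw [tendsto_iff_norm_sub_tendsto_zero] at h ⊢
  exact squeeze_zero (fun _ => norm_nonneg _) (fun i => norm_apply_le (f i - a) x) h

theorem IsContractive.tendsto {T : A →ₗ[ℂ] A} (hT : IsContractive T) {ι : Type*} {l : Filter ι}
    {f : ι → A} {a : A} (h : Tendsto f l (𝓝 a)) : Tendsto (fun i => T (f i)) l (𝓝 (T a)) := by
  rw [tendsto_iff_norm_sub_tendsto_zero] at h ⊢
  refine squeeze_zero (fun _ => norm_nonneg _) (fun i => ?_) h
  rw [← map_sub]
  exact hT _

theorem IsUniformAlgebra.exists_sectorial_seq (hA : IsUniformAlgebra A) (F : Finset A) :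
    ∃ e : ℕ → A, (∀ n, ‖e n‖ ≤ 1) ∧ (∀ a ∈ F, Tendsto (fun n => e n * a) atTop (𝓝 a)) ∧
      ∀ n (x : K), ∃ ρ : ℝ, 0 ≤ ρ ∧ ‖(e n : C(K, ℂ)) x - ρ‖ ≤ 1 / ((n : ℝ) + 1) * ρ := by
  choose e he using fun n : ℕ =>
    hA.exists_sectorial F (ε := 1 / ((n : ℝ) + 1)) (by positivity)
  refine ⟨e, fun n => (he n).1, fun a ha => ?_, fun n => (he n).2.2⟩
  rw [tendsto_iff_norm_sub_tendsto_zero]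
  exact squeeze_zero (fun _ => norm_nonneg _) (fun n => (he n).2.1 a ha)
    tendsto_one_div_add_atTop_nhds_zero_nat

-- Positivity of `P` on the formal element `r + a` of the unitization, with `v` in the role of the
-- value of `P 1` at `x`. The strict margin `c` absorbs the sector error of `e n` for large `n`.
set_option maxHeartbeats 1000000 in
theorem IsRealPositiveMap.re_nonneg_of_tendsto {P : A →ₗ[ℂ] A} (hpos : IsRealPositiveMap P)
    (hP : IsContractive P) {e : ℕ → A}
    (hsec : ∀ n (x : K), ∃ ρ : ℝ, 0 ≤ ρ ∧ ‖(e n : C(K, ℂ)) x - ρ‖ ≤ 1 / ((n : ℝ) + 1) * ρ)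
    {a : A} (ha : Tendsto (fun n => e n * a) atTop (𝓝 a)) {x : K} {v : ℂ}
    (hv : Tendsto (fun n => (P (e n) : C(K, ℂ)) x) atTop (𝓝 v)) {r : ℂ} {c : ℝ} (hc : 0 < c)
    (hr : ∀ z, c ≤ (r + (a : C(K, ℂ)) z).re) : 0 ≤ (r * v + (P a : C(K, ℂ)) x).re := by
  have h1 : ∀ᶠ n : ℕ in atTop, 0 ≤ (r * (P (e n) : C(K, ℂ)) x + (P (e n * a) : C(K, ℂ)) x).re := by
    have h2 : Tendsto (fun n : ℕ => 1 / ((n : ℝ) + 1) * (‖r‖ + ‖a‖)) atTop (𝓝 0) := by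
      have h3 := (tendsto_one_div_add_atTop_nhds_zero_nat (𝕜 := ℝ)).mul_const (‖r‖ + ‖a‖)
      rwa [zero_mul] at h3
    filter_upwards [h2.eventually_le_const hc] with n hn
    have h3 : IsRealPositive (r • e n + e n * a) := by
      intro z
      have h4 : ((r • e n + e n * a : A) : C(K, ℂ)) z
          = (e n : C(K, ℂ)) z * (r + (a : C(K, ℂ)) z) := by
        change r * (e n : C(K, ℂ)) z + (e n : C(K, ℂ)) z * (a : C(K, ℂ)) z = _
        ring
      rw [h4]
      obtain ⟨ρ, hρ, h⟩ := hsec n z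
      refine re_mul_nonneg_of_sector hρ h (le_trans ?_ (hn.trans (hr z)))
      gcongr
      exact (norm_add_le _ _).trans (by gcongr; exact UniformAlg.norm_apply_le a z)
    have h5 := hpos _ h3 x
    rw [map_add, map_smul] at h5
    exact h5
  refine ge_of_tendsto ?_ h1
  exact (Complex.continuous_re.tendsto _).comp
    ((hv.const_mul r).add (tendsto_apply (hP.tendsto ha) x))

/-- At each point, a real positive projection whose associated symmetry is contractive either
vanishes, or the symmetry is multiplicative. -/
theorem apply_eq_zero_or_mul (hA : IsUniformAlgebra A) {P T : A →ₗ[ℂ] A}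
    (hpos : IsRealPositiveMap P) (hP : IsContractive P) (hT : IsContractive T)
    (hTT : ∀ a, T (T a) = a)
    (hPT : ∀ a x, (P a : C(K, ℂ)) x = (1 / 2 : ℂ) * ((a : C(K, ℂ)) x + (T a : C(K, ℂ)) x))
    (x : K) :
    (∀ a, (P a : C(K, ℂ)) x = 0) ∨
      ∀ a b, (T (a * b) : C(K, ℂ)) x = (T a : C(K, ℂ)) x * (T b : C(K, ℂ)) x := by
  classical
  by_cases h0 : ∀ a, (T a : C(K, ℂ)) x = 0
  · right
    intro a b
    rw [h0, h0, zero_mul]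
  push Not at h0
  obtain ⟨k, hk⟩ := h0
  have hmul : ∀ b c j : A, (T c : C(K, ℂ)) x * (T (b * j) : C(K, ℂ)) x
      = (T j : C(K, ℂ)) x * (T (b * c) : C(K, ℂ)) x := fun b c j =>
    congrArg (fun a : A => (a : C(K, ℂ)) x) (apply_mul_apply_mul hT hTT b c j)
  obtain ⟨d, hd⟩ : ∃ d : A, (T (d * k) : C(K, ℂ)) x ≠ 0 := by
    obtain ⟨e, -, he, -⟩ := hA.exists_sectorial_seq {k}
    have h1 := tendsto_apply (hT.tendsto (he k (by simp))) x
    obtain ⟨n, hn⟩ := (h1.eventually_ne hk).exists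
    exact ⟨e n, hn⟩
  -- the weight of the weighted composition operator at `x`
  obtain ⟨u, hu⟩ : ∃ u : ℂ, ∀ a b, u * (T (a * b) : C(K, ℂ)) x
      = (T a : C(K, ℂ)) x * (T b : C(K, ℂ)) x := by
    refine ⟨(T k : C(K, ℂ)) x * (T d : C(K, ℂ)) x / (T (d * k) : C(K, ℂ)) x, fun a b => ?_⟩
    rw [div_mul_eq_mul_div, div_eq_iff hd]
    have h1 := hmul d a k
    have h2 := hmul a d b
    rw [mul_comm a d] at h2
    linear_combination (T k : C(K, ℂ)) x * h2 - (T b : C(K, ℂ)) x * h1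
  have hlim : ∀ e : ℕ → A, Tendsto (fun n => e n * k) atTop (𝓝 k) →
      Tendsto (fun n => (T (e n) : C(K, ℂ)) x) atTop (𝓝 u) := by
    intro e he
    have h1 := ((tendsto_apply (hT.tendsto he) x).const_mul u).div_const ((T k : C(K, ℂ)) x)
    rw [mul_div_cancel_right₀ _ hk] at h1
    refine h1.congr fun n => ?_
    rw [hu, mul_div_cancel_right₀ _ hk]
  have hlim1 : ∀ e : ℕ → A, Tendsto (fun n => e n * T k) atTop (𝓝 (T k)) →
      Tendsto (fun n => (e n : C(K, ℂ)) x) atTop (𝓝 1) := by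
    intro e he
    have h1 := (tendsto_apply he x).div_const ((T k : C(K, ℂ)) x)
    rw [div_self hk] at h1
    refine h1.congr fun n => ?_
    change (e n : C(K, ℂ)) x * (T k : C(K, ℂ)) x / _ = _
    rw [mul_div_cancel_right₀ _ hk]
  have hlimP : ∀ e : ℕ → A, Tendsto (fun n => e n * k) atTop (𝓝 k) →
      Tendsto (fun n => e n * T k) atTop (𝓝 (T k)) →
      Tendsto (fun n => (P (e n) : C(K, ℂ)) x) atTop (𝓝 ((1 / 2 : ℂ) * (1 + u))) := by
    intro e he he'
    simp_rw [hPT]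
    exact ((hlim1 e he').add (hlim e he)).const_mul _
  have hu1 : ‖u‖ = 1 := by
    obtain ⟨e, he1, he, -⟩ := hA.exists_sectorial_seq {k, T k}
    have h1 := hlim e (he k (by simp))
    have h2 := hlim1 e (he (T k) (by simp))
    refine le_antisymm (le_of_tendsto h1.norm (Eventually.of_forall fun n =>
      (hT.norm_apply_le _ x).trans (he1 n))) ?_
    -- Taking both factors to be `T (e n)` in `hu` gives `e n x ^ 2` as `u` times a number of
    -- modulus at most 1.
    have h3 : ∀ n, ‖(e n : C(K, ℂ)) x‖ * ‖(e n : C(K, ℂ)) x‖ ≤ ‖u‖ := by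
      intro n
      have h4 := hu (T (e n)) (T (e n))
      rw [hTT] at h4
      rw [← norm_mul, ← h4, norm_mul]
      refine mul_le_of_le_one_right (norm_nonneg _) ((hT.norm_apply_le _ x).trans ?_)
      exact (norm_mul_le _ _).trans (mul_le_one₀ ((hT _).trans (he1 n)) (norm_nonneg _)
        ((hT _).trans (he1 n)))
    have h5 := le_of_tendsto (h2.norm.mul h2.norm) (Eventually.of_forall h3)
    simpa using h5
  have huim : u.im = 0 := by
    obtain ⟨e, he1, he, hsec⟩ := hA.exists_sectorial_seq {k, T k, 0}
    have h1 := hlimP e (he k (by simp)) (he (T k) (by simp))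
    set v := (1 / 2 : ℂ) * (1 + u) with hv
    -- Positivity for the constants `1 + i s`, with `s` of either sign and arbitrarily large, forces
    -- `v` to be real.
    have h2 : ∀ s : ℝ, 0 ≤ v.re - s * v.im := by
      intro s
      have h3 := hpos.re_nonneg_of_tendsto hP hsec (he 0 (by simp)) h1 (r := ⟨1, s⟩) one_pos
        (fun z => by
          change (1 : ℝ) ≤ (⟨1, s⟩ + 0 : ℂ).re
          rw [add_zero])
      rw [map_zero] at h3
      change 0 ≤ ((⟨1, s⟩ : ℂ) * v + 0).re at h3
      rw [add_zero, Complex.mul_re, one_mul] at h3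
      exact h3
    have h4 : v.im = 0 := by
      by_contra h
      have h5 := h2 ((v.re + 1) / v.im)
      rw [div_mul_cancel₀ _ h] at h5
      linarith
    have h6 : u = 2 * v - 1 := by rw [hv]; ring
    rw [h6]
    simp [h4]
  have hu2 : u = 1 ∨ u = -1 := by
    have h1 : u = (u.re : ℂ) := Complex.ext rfl (by simpa using huim)
    rw [h1, Complex.norm_real, Real.norm_eq_abs] at hu1
    rcases eq_or_eq_neg_of_abs_eq hu1 with h | h
    · left; rw [h1, h, Complex.ofReal_one]
    · right; rw [h1, h, Complex.ofReal_neg, Complex.ofReal_one]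
  rcases hu2 with rfl | rfl
  · right
    intro a b
    rw [← hu, one_mul]
  · left
    intro a
    -- For `u = -1` the limit of `P (e n)` at `x` is 0, so adding a large constant to any element
    -- makes it positive at no cost and its image has nonnegative real part at `x`. This `θ` makes
    -- that real part `-|P a (x)|²`.
    set θ : ℂ := -(starRingEnd ℂ) ((P a : C(K, ℂ)) x) with hθ
    obtain ⟨e, he1, he, hsec⟩ := hA.exists_sectorial_seq {k, T k, θ • a}
    have h1 := hlimP e (he k (by simp)) (he (T k) (by simp))
    have h2 := hpos.re_nonneg_of_tendsto hP hsec (he (θ • a) (by simp)) h1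
      (r := ((‖θ • a‖ + 1 : ℝ) : ℂ)) one_pos (fun z => by
        have h3 := (abs_le.1 ((Complex.abs_re_le_norm _).trans
          (UniformAlg.norm_apply_le (θ • a) z))).1
        rw [Complex.add_re, Complex.ofReal_re]
        linarith)
    rw [map_smul, add_neg_cancel, mul_zero, mul_zero, zero_add] at h2
    change 0 ≤ (θ * (P a : C(K, ℂ)) x).re at h2
    rw [hθ, neg_mul, ← Complex.normSq_eq_conj_mul_self, Complex.neg_re, Complex.ofReal_re] at h2
    exact Complex.normSq_eq_zero.1 (le_antisymm (by linarith) (Complex.normSq_nonneg _))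

end UniformAlg

theorem theorem3 {K : Type*} [TopologicalSpace K] [CompactSpace K] [T2Space K]
    (A : NonUnitalSubalgebra ℂ C(K, ℂ)) (hA : UniformAlg.IsUniformAlgebra A)
    (P : A →ₗ[ℂ] A) (hproj : IsIdempotentElem P)
    (hpos : UniformAlg.IsRealPositiveMap P) (hbi : UniformAlg.IsBicontractive P) :
    UniformAlg.IsSymmetricProj P ∧
      (∃ B : NonUnitalSubalgebra ℂ A, (B : Set A) = Set.range P) ∧
      UniformAlg.IsCondExp P := by
  have hsym := UniformAlg.isSymmetricProj hA hpos hbi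
  have hPP : ∀ a, P (P a) = P a := fun a => LinearMap.congr_fun hproj a
  set T : A →ₗ[ℂ] A := (2 : ℂ) • P - LinearMap.id with hTdef
  have hTa : ∀ a, T a = (2 : ℂ) • P a - a := fun a => rfl
  have hT : UniformAlg.IsContractive T := fun a => by
    rw [hTa, norm_sub_rev]; exact hsym a
  have hTT : ∀ a, T (T a) = a := fun a => by
    rw [hTa, hTa, map_sub, map_smul, hPP, two_smul ℂ (P a), add_sub_cancel_right, two_smul]
    abel
  have hPT : ∀ (a : A) (x : K), (P a : C(K, ℂ)) x
      = (1 / 2 : ℂ) * ((a : C(K, ℂ)) x + (T a : C(K, ℂ)) x) := fun a x => by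
    change _ = (1 / 2 : ℂ) * ((a : C(K, ℂ)) x + (2 * (P a : C(K, ℂ)) x - (a : C(K, ℂ)) x))
    ring
  have hTP : ∀ a, T (P a) = P a := fun a => by
    rw [hTa, hPP, two_smul, add_sub_cancel_right]
  have hdich := UniformAlg.apply_eq_zero_or_mul hA hpos hbi.1 hT hTT hPT
  have hmul : ∀ a c, P (P a * P c) = P a * P c := fun a c => by
    refine Subtype.ext (ContinuousMap.ext fun x => ?_)
    change _ = (P a : C(K, ℂ)) x * (P c : C(K, ℂ)) x
    rcases hdich x with h | h
    · rw [h, h, zero_mul]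
    · rw [hPT, h, hTP, hTP]
      change (1 / 2 : ℂ) * ((P a : C(K, ℂ)) x * (P c : C(K, ℂ)) x + _) = _
      ring
  refine ⟨hsym, ⟨{ LinearMap.range P with
    mul_mem' := ?_ }, ?_⟩, fun a b c => ?_⟩
  · rintro _ _ ⟨a, rfl⟩ ⟨c, rfl⟩
    exact ⟨P a * P c, hmul a c⟩
  · rfl
  · refine Subtype.ext (ContinuousMap.ext fun x => ?_)
    change _ = (P a : C(K, ℂ)) x * (P b : C(K, ℂ)) x * (P c : C(K, ℂ)) x
    rcases hdich x with h | h
    · rw [h, h, zero_mul, zero_mul]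
    -- Here `P = (I + T)/2` with `T` multiplicative at `x` and fixing the range of `P`, so the outer
    -- factors come out.
    · rw [hPT, hPT b, h, h, hTP, hTP]
      change (1 / 2 : ℂ) * ((P a : C(K, ℂ)) x * (b : C(K, ℂ)) x * (P c : C(K, ℂ)) x + _) = _
      ring
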